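/- Let $n,t\in\mathbb N$ and let $G$ be an infinite ring (associative, not necessarily commutative or unital). Call a map $P=(p_1,\dots,p_t):G^n\to G^t$ polynomial if each $p_l:G^n\to G$ lies in the subring of the ring of all functions $G^n\to G$ (with pointwise operations) generated by the constants and the $n$ coordinate functions; that is, $p_l$ is given by a polynomial in the variables $x_1,\dots,x_n$ over $G$, where, if $G$ is not commutative, coefficients may stand anywhere in a monomial. Let $P:G^n\to G^t$ be a polynomial map with $P(0)=0$, let $F\subset G^n$ be a finite set, let $r\in\mathbb N$, and let $\chi:G^t\to\{1,\dots,r\}$ be a coloring. Then there are $h\in G^t$ and $x\in G$ with $x\neq 0$ such that $\chi$ is constant on the set $$h+P(xF)=\{\,h+P(xv_1,\dots,xv_n) : (v_1,\dots,v_n)\in F\,\}.$$ -/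

import Mathlib

/-- The ring of polynomial functions `G^n → G` in `n` variables over a ring `G` (associative, not
necessarily commutative or unital): the subring of the ring of all functions `G^n → G` generated
by the constants and the coordinates. Its elements are the functions given by finite sums of
monomials in the variables `x₁, …, xₙ`, where coefficients from `G` may stand anywhere among the
(noncommuting) variables. If `G` is commutative and unital, they are the evaluations of elements
of `G[x₁, …, xₙ]`. -/
def polynomialFunctionRing (G : Type*) [NonUnitalRing G] (n : ℕ) :
    NonUnitalSubring ((Fin n → G) → G) :=
  NonUnitalSubring.closure
    (Set.range (fun (c : G) (_ : Fin n → G) => c) ∪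
      Set.range (fun (i : Fin n) (x : Fin n → G) => x i))

/-- `P : G^n → G^t` is a polynomial mapping over `G`: each of its `t` components is given by a
polynomial over `G` in `n` variables. -/
def IsPolynomialMapping {G : Type*} [NonUnitalRing G] {n t : ℕ}
    (P : (Fin n → G) → (Fin t → G)) : Prop :=
  ∀ l : Fin t, (fun x => P x l) ∈ polynomialFunctionRing G n

/-- The coloring `χ` is constant on `M`. -/
def IsMonochromatic {W C : Type*} (χ : W → C) (M : Set W) : Prop :=
  ∀ a ∈ M, ∀ b ∈ M, χ a = χ b

/-!
For `v ∈ F` the map `x ↦ P (x v) - P 0` from `(G, +)` to `(G ^ t, +)` vanishes at `0` and has finite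
degree, in the sense that its iterated differences of some order vanish. The theorem is therefore an
instance of the polynomial van der Waerden theorem for finitely many such maps between abelian
groups, which is proved by Walters' color focusing. The induction is Bergelson's PET induction:
focusing reduces a family `A` to the families of the maps `x ↦ p (x + y) - p y - q x` with `p ∈ A`,
where `q ∈ A` has minimal degree. Call two maps of the same degree equivalent if their difference
has smaller degree. The reduction trades the class of `q` for finitely many classes of smaller
degree, so the multiset of the degrees of the classes decreases in the hydra order.
-/

open Function
open scoped fwdDiff

/-- The polynomial maps `M → H` of degree less than `d`, in the intrinsic sense that all their
`d`-fold differences vanish. -/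
def degreeLT (M H : Type*) [AddCommMonoid M] [AddCommGroup H] : ℕ → AddSubgroup (M → H)
  | 0 => ⊥
  | d + 1 => ⨅ y, (degreeLT M H d).comap (fwdDiff_aux.fwdDiffₗ M H y).toAddMonoidHom

section DegreeLT

variable {M H R : Type*} [AddCommMonoid M] [AddCommGroup H] [NonUnitalRing R]

theorem mem_degreeLT_zero {f : M → H} : f ∈ degreeLT M H 0 ↔ f = 0 := AddSubgroup.mem_bot

theorem mem_degreeLT_succ {d : ℕ} {f : M → H} :
    f ∈ degreeLT M H (d + 1) ↔ ∀ y, Δ_[y] f ∈ degreeLT M H d := AddSubgroup.mem_iInf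

theorem degreeLT_mono : Monotone (degreeLT M H) := by
  refine monotone_nat_of_le_succ fun d => ?_
  induction d with
  | zero => exact bot_le
  | succ d ih => exact fun f hf => mem_degreeLT_succ.2 fun y => ih (mem_degreeLT_succ.1 hf y)

theorem const_mem_degreeLT (d : ℕ) (c : H) : (fun _ : M => c) ∈ degreeLT M H (d + 1) := by
  refine mem_degreeLT_succ.2 fun y => ?_
  rw [fwdDiff_const]
  exact zero_mem _

theorem addMonoidHom_mem_degreeLT_two (φ : M →+ H) : ⇑φ ∈ degreeLT M H 2 := by
  refine mem_degreeLT_succ.2 fun y => ?_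
  have hΔ : Δ_[y] φ = fun _ => φ y := by
    ext x
    rw [fwdDiff, map_add, add_sub_cancel_left]
  rw [hΔ]
  exact const_mem_degreeLT 0 _

theorem eq_zero_of_mem_degreeLT_one {f : M → H} (hf : f ∈ degreeLT M H 1) (h0 : f 0 = 0) :
    f = 0 := by
  ext y
  simpa [fwdDiff, h0] using congrFun (mem_degreeLT_zero.1 (mem_degreeLT_succ.1 hf y)) 0

theorem fwdDiff_sub_const_mem_degreeLT {d : ℕ} {f : M → H} (hf : f ∈ degreeLT M H (d + 1))
    (h0 : f 0 = 0) (y : M) : (fun x => Δ_[y] f x - f y) ∈ degreeLT M H d := by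
  cases d with
  | zero =>
    obtain rfl := eq_zero_of_mem_degreeLT_one hf h0
    exact mem_degreeLT_zero.2 (by ext; simp [fwdDiff])
  | succ d => exact sub_mem (mem_degreeLT_succ.1 hf y) (const_mem_degreeLT d (f y))

theorem pi_mem_degreeLT {ι : Type*} {H : ι → Type*} [∀ i, AddCommGroup (H i)] {d : ℕ}
    {f : M → ∀ i, H i} (hf : ∀ i, (fun x => f x i) ∈ degreeLT M (H i) d) :
    f ∈ degreeLT M (∀ i, H i) d := by
  induction d generalizing f with
  | zero => exact mem_degreeLT_zero.2 <| funext₂ fun x i => congrFun (mem_degreeLT_zero.1 (hf i)) x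
  | succ d ih =>
    exact mem_degreeLT_succ.2 fun y => ih fun i => mem_degreeLT_succ.1 (hf i) y

theorem fwdDiff_mul (y : M) (f g : M → R) :
    Δ_[y] (f * g) = Δ_[y] f * g + f * Δ_[y] g + Δ_[y] f * Δ_[y] g := by
  ext x
  simp only [fwdDiff, Pi.add_apply, Pi.mul_apply]
  noncomm_ring

theorem mul_mem_degreeLT {a b : ℕ} {f g : M → R} (hf : f ∈ degreeLT M R a)
    (hg : g ∈ degreeLT M R b) : f * g ∈ degreeLT M R (a + b) := by
  induction hn : a + b generalizing a b f g with
  | zero =>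
    obtain rfl : a = 0 := by omega
    rw [mem_degreeLT_zero.1 hf, zero_mul]
    exact zero_mem _
  | succ n ih =>
    rcases a with _ | a
    · rw [mem_degreeLT_zero.1 hf, zero_mul]
      exact zero_mem _
    rcases b with _ | b
    · rw [mem_degreeLT_zero.1 hg, mul_zero]
      exact zero_mem _
    refine mem_degreeLT_succ.2 fun y => ?_
    have hΔf : Δ_[y] f ∈ degreeLT M R a := mem_degreeLT_succ.1 hf y
    have hΔg : Δ_[y] g ∈ degreeLT M R b := mem_degreeLT_succ.1 hg y
    rw [fwdDiff_mul]
    exact add_mem (add_mem (ih hΔf hg (by omega)) (ih hf hΔg (by omega)))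
      (ih hΔf (degreeLT_mono b.le_succ hΔg) (by omega))

/-- The ring of the maps `M → R` of finite degree, that is, with vanishing `d`-fold differences for
some `d`. -/
def finiteDegreeSubring (M R : Type*) [AddCommMonoid M] [NonUnitalRing R] :
    NonUnitalSubring (M → R) where
  carrier := {f | ∃ d, f ∈ degreeLT M R d}
  zero_mem' := ⟨0, zero_mem _⟩
  add_mem' := fun ⟨a, ha⟩ ⟨b, hb⟩ =>
    ⟨max a b, add_mem (degreeLT_mono (le_max_left a b) ha) (degreeLT_mono (le_max_right a b) hb)⟩
  neg_mem' := fun ⟨a, ha⟩ => ⟨a, neg_mem ha⟩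
  mul_mem' := fun ⟨a, ha⟩ ⟨b, hb⟩ => ⟨a + b, mul_mem_degreeLT ha hb⟩

theorem comp_mem_finiteDegreeSubring {n : ℕ} {f : (Fin n → R) → R}
    (hf : f ∈ polynomialFunctionRing R n) {φ : M → Fin n → R}
    (hφ : ∀ i, (fun x => φ x i) ∈ finiteDegreeSubring M R) : f ∘ φ ∈ finiteDegreeSubring M R := by
  induction hf using NonUnitalSubring.closure_induction with
  | mem f hf =>
    rcases hf with ⟨c, rfl⟩ | ⟨i, rfl⟩
    · exact ⟨1, const_mem_degreeLT 0 c⟩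
    · exact hφ i
  | zero => exact zero_mem _
  | add f g _ _ hf hg => exact add_mem hf hg
  | neg f _ hf => exact neg_mem hf
  | mul f g _ _ hf hg => exact mul_mem hf hg

theorem IsPolynomialMapping.exists_mem_degreeLT {n t : ℕ} {P : (Fin n → R) → (Fin t → R)}
    (hP : IsPolynomialMapping P) (v : Fin n → R) :
    ∃ d, (fun x : R => P fun i => x * v i) ∈ degreeLT R (Fin t → R) d := by
  choose d hd using fun l => comp_mem_finiteDegreeSubring (hP l) (φ := fun (x : R) i => x * v i)
    fun i => ⟨2, addMonoidHom_mem_degreeLT_two (AddMonoidHom.mulRight (v i))⟩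
  exact ⟨Finset.univ.sup d, pi_mem_degreeLT fun l =>
    degreeLT_mono (Finset.le_sup (Finset.mem_univ l)) (hd l)⟩

end DegreeLT

section PartitionRegular

variable {M H : Type*} [AddCommGroup H] {A : Set (M → H)}

/-- Every finite coloring of `H` is constant on some configuration `{h} ∪ {h + p x | p ∈ A}` with
`x` outside a prescribed finite set. -/
def IsPartitionRegular (A : Set (M → H)) : Prop :=
  ∀ ⦃r : ℕ⦄ (χ : H → Fin r) ⦃S : Set M⦄, S.Finite → ∃ h, ∃ x ∉ S, ∀ p ∈ A, χ (h + p x) = χ h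

namespace IsPartitionRegular

theorem empty [Infinite M] : IsPartitionRegular (∅ : Set (M → H)) := fun _ _ _ hS =>
  let ⟨x, hx⟩ := hS.exists_notMem
  ⟨0, x, hx, by simp⟩

theorem of_diff_zero (hA : IsPartitionRegular (A \ {0})) : IsPartitionRegular A := by
  intro r χ S hS
  obtain ⟨h, x, hx, hχ⟩ := hA χ hS
  refine ⟨h, x, hx, fun p hp => ?_⟩
  by_cases hp0 : p = 0
  · simp [hp0]
  · exact hχ p ⟨hp, hp0⟩

theorem exists_of_finite (hA : IsPartitionRegular A) {C : Type*} [Finite C] (χ : H → C)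
    {S : Set M} (hS : S.Finite) : ∃ h, ∃ x ∉ S, ∀ p ∈ A, χ (h + p x) = χ h := by
  obtain ⟨r, ⟨e⟩⟩ := Finite.exists_equiv_fin C
  obtain ⟨h, x, hx, hχ⟩ := hA (e ∘ χ) hS
  exact ⟨h, x, hx, fun p hp => e.injective (hχ p hp)⟩

/-- Color `h` by the pattern of `χ` on the translate `h + Q`. -/
theorem exists_forall_translate (hA : IsPartitionRegular A) {C : Type*} [Finite C] (χ : H → C)
    {Q : Set H} (hQ : Q.Finite) {S : Set M} (hS : S.Finite) :
    ∃ h, ∃ x ∉ S, ∀ p ∈ A, ∀ z ∈ Q, χ (h + p x + z) = χ (h + z) := by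
  have := hQ.to_subtype
  obtain ⟨h, x, hx, hχ⟩ := hA.exists_of_finite (fun h (z : Q) => χ (h + z)) hS
  exact ⟨h, x, hx, fun p hp z hz => congrFun (hχ p hp) ⟨z, hz⟩⟩

end IsPartitionRegular

/-- The colorings of `H` that are not constant on any configuration `{h} ∪ {h + p x | p ∈ A}` with
`x ∉ S`, the counterexamples to the partition regularity of `A`. -/
def avoidingColorings (A : Set (M → H)) (S : Set M) (C : Type*) : Set (H → C) :=
  {χ | ∀ h, ∀ x ∉ S, ∃ p ∈ A, χ (h + p x) ≠ χ h}

theorem translate_mem_avoidingColorings {S : Set M} {C : Type*} {χ : H → C}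
    (hχ : χ ∈ avoidingColorings A S C) (h : H) :
    (fun z => χ (h + z)) ∈ avoidingColorings A S C := fun a x hx => by
  simpa only [add_assoc] using hχ (h + a) x hx

theorem isClosed_avoidingColorings (hA : A.Finite) (S : Set M) (C : Type*) [TopologicalSpace C]
    [DiscreteTopology C] : IsClosed (avoidingColorings A S C) := by
  have hne (a b : H) : IsClosed {χ : H → C | χ a ≠ χ b} :=
    IsClosed.preimage (f := fun χ : H → C => (χ a, χ b)) (by fun_prop)
      (isClosed_discrete {c : C × C | c.1 ≠ c.2})
  simp only [avoidingColorings, Set.ofPred_forall]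
  refine isClosed_iInter fun h => isClosed_iInter fun x => isClosed_iInter fun _ => ?_
  convert hA.isClosed_biUnion fun p _ => hne (h + p x) h
  ext χ
  simp

/-- The configurations `{h + p (y c) | p ∈ A}` with the common focus `h`, one for each color
`c ∈ T`, are monochromatic of color `c`. -/
def IsFocused {C : Type*} (A : Set (M → H)) (χ : H → C) (h : H) (y : C → M) (T : Finset C) : Prop :=
  ∀ c ∈ T, ∀ p ∈ A, χ (h + p (y c)) = c

theorem isOpen_setOf_isFocused (hA : A.Finite) {C : Type*} [TopologicalSpace C]
    [DiscreteTopology C] (h : H) (y : C → M) (T : Finset C) :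
    IsOpen {χ | IsFocused A χ h y T} := by
  simp only [IsFocused, Set.ofPred_forall]
  exact isOpen_biInter_finset fun c _ => hA.isOpen_biInter fun p _ =>
    IsOpen.preimage (f := fun χ : H → C => χ (h + p (y c))) (by fun_prop) (isOpen_discrete {c})

/-- Compactness of the space of avoiding colorings bounds the focused configurations uniformly. -/
theorem exists_finite_isFocused (hA : A.Finite) {S : Set M} {C : Type*} [Finite C] {k : ℕ}
    (hfocus : ∀ χ ∈ avoidingColorings A S C,
      ∃ h y T, T.card = k ∧ (∀ c ∈ T, y c ∉ S) ∧ IsFocused A χ h y T) :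
    ∃ (E : Set H) (D : Set M), E.Finite ∧ D.Finite ∧ ∀ χ ∈ avoidingColorings A S C,
      ∃ h ∈ E, ∃ y T, T.card = k ∧ (∀ c ∈ T, y c ∉ S) ∧ (∀ c, y c ∈ D) ∧ IsFocused A χ h y T := by
  let _ : TopologicalSpace C := ⊥
  have : DiscreteTopology C := ⟨rfl⟩
  let I : Set (H × (C → M) × Finset C) := {i | i.2.2.card = k ∧ ∀ c ∈ i.2.2, i.2.1 c ∉ S}
  obtain ⟨J, hJI, hJ, hcover⟩ :=
    (isClosed_avoidingColorings hA S C).isCompact.elim_finite_subcover_image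
      (b := I) (c := fun i => {χ | IsFocused A χ i.1 i.2.1 i.2.2})
      (fun i _ => isOpen_setOf_isFocused hA i.1 i.2.1 i.2.2) fun χ hχ => by
        obtain ⟨h, y, T, hT, hyS, hy⟩ := hfocus χ hχ
        exact Set.mem_biUnion (x := (h, y, T)) ⟨hT, hyS⟩ hy
  refine ⟨Prod.fst '' J, ⋃ i ∈ J, Set.range i.2.1, hJ.image _,
    hJ.biUnion fun i _ => Set.finite_range _, fun χ hχ => ?_⟩
  obtain ⟨i, hi, hfoc⟩ := Set.mem_iUnion₂.1 (hcover hχ)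
  exact ⟨i.1, Set.mem_image_of_mem _ hi, i.2.1, i.2.2, (hJI hi).1, (hJI hi).2,
    fun c => Set.mem_biUnion hi (Set.mem_range_self c), hfoc⟩

theorem IsFocused.insert_zero [Zero M] {C : Type*} [DecidableEq C] {χ : H → C} {h : H} {y : C → M}
    {T : Finset C} (hA0 : ∀ p ∈ A, p 0 = 0) (hy : IsFocused A χ h y T) (hT : χ h ∉ T) :
    IsFocused A χ h (update y (χ h) 0) (insert (χ h) T) := by
  intro c hc p hp
  rcases Finset.mem_insert.1 hc with rfl | hc
  · rw [update_self, hA0 p hp, add_zero]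
  · rw [update_of_ne (ne_of_mem_of_not_mem hc hT)]
    exact hy c hc p hp

/-- The family of the maps `x ↦ p (x + y) - p y - q x` with `p ∈ A` and `y ∈ Y`, to which color
focusing reduces the family `A`. -/
def shiftedFamily [Add M] (A : Set (M → H)) (q : M → H) (Y : Set M) : Set (M → H) :=
  Set.image2 (fun p y x => p (x + y) - p y - q x) A Y

theorem IsFocused.translate [Add M] {C : Type*} {χ : H → C} {h a : H} {x : M} {y : C → M}
    {T : Finset C} {q : M → H} {Y : Set M} {Q : Set H} (hy : IsFocused A (fun z => χ (h + z)) a y T)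
    (hχ : ∀ g ∈ shiftedFamily A q Y, ∀ z ∈ Q, χ (h + g x + z) = χ (h + z))
    (hY : ∀ c ∈ T, y c ∈ Y) (hQ : ∀ c ∈ T, ∀ p ∈ A, a + p (y c) ∈ Q) :
    IsFocused A χ (h + a - q x) (fun c => x + y c) T := fun c hc p hp =>
  calc χ (h + a - q x + p (x + y c))
      = χ (h + (p (x + y c) - p (y c) - q x) + (a + p (y c))) := by congr 1; abel
    _ = χ (h + (a + p (y c))) := hχ _ (Set.mem_image2_of_mem hp (hY c hc)) _ (hQ c hc p hp)
    _ = c := hy c hc p hp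

variable [AddCancelCommMonoid M]

theorem exists_isFocused_card_eq (hA : A.Finite) (hA0 : ∀ p ∈ A, p 0 = 0) (q : M → H)
    (hB : ∀ Y : Set M, Y.Finite → IsPartitionRegular (shiftedFamily A q Y))
    {C : Type*} [Finite C] {S : Set M} (hS : S.Finite) (k : ℕ) :
    ∀ χ ∈ avoidingColorings A S C,
      ∃ h y T, T.card = k ∧ (∀ c ∈ T, y c ∉ S) ∧ IsFocused A χ h y T := by
  classical
  induction k with
  | zero => exact fun _ _ => ⟨0, 0, ∅, rfl, by simp, by simp [IsFocused]⟩
  | succ k ih =>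
    intro χ hχ
    obtain ⟨E, D, hE, hD, hED⟩ := exists_finite_isFocused hA ih
    let Y : Set M := insert 0 D
    let Q : Set H := Set.image2 (· + ·) E (Set.image2 (fun p y => p y) A Y)
    have hY : Y.Finite := hD.insert 0
    have hS' : (⋃ y ∈ Y, (· + y) ⁻¹' S).Finite :=
      hY.biUnion fun y _ => hS.preimage (add_left_injective y).injOn
    obtain ⟨h, x, hx, hshift⟩ :=
      (hB Y hY).exists_forall_translate χ (hE.image2 _ (hA.image2 _ hY) : Q.Finite) hS'
    obtain ⟨a, ha, y, T, hT, hyS, hyD, hy⟩ := hED _ (translate_mem_avoidingColorings hχ h)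
    have hnew : χ (h + a) ∉ T := fun hmem => by
      obtain ⟨p, hp, hne⟩ := hχ (h + a) _ (hyS _ hmem)
      exact hne (by simpa only [add_assoc] using hy _ hmem p hp)
    have hyY : ∀ c, update y (χ (h + a)) 0 c ∈ Y :=
      forall_update_iff y (p := fun _ m => m ∈ Y) |>.2
        ⟨Set.mem_insert _ _, fun c _ => Set.mem_insert_of_mem _ (hyD c)⟩
    refine ⟨h + a - q x, fun c => x + update y (χ (h + a)) 0 c, insert (χ (h + a)) T, ?_, ?_, ?_⟩
    · rw [Finset.card_insert_of_notMem hnew, hT]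
    · exact fun c _ hc => hx (Set.mem_biUnion (hyY c) hc)
    · exact (hy.insert_zero hA0 hnew).translate hshift (fun c _ => hyY c) fun c _ p hp =>
        Set.mem_image2_of_mem ha (Set.mem_image2_of_mem hp (hyY c))

theorem IsPartitionRegular.of_shiftedFamily (hA : A.Finite) (hA0 : ∀ p ∈ A, p 0 = 0) (q : M → H)
    (hB : ∀ Y : Set M, Y.Finite → IsPartitionRegular (shiftedFamily A q Y)) :
    IsPartitionRegular A := by
  intro r χ S hS
  by_contra! hχ
  obtain ⟨-, -, T, hT, -⟩ := exists_isFocused_card_eq hA hA0 q hB hS (r + 1) χ hχ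
  have hcard : T.card ≤ r := T.card_le_univ.trans_eq (Fintype.card_fin r)
  omega

end PartitionRegular

section DegreeCover

variable {M H : Type*} [AddCommGroup H] {A : Set (M → H)} {K : Multiset ((M → H) × ℕ)}

/-- Each map in `A` lies in one of the classes given by the pairs `(f, d)` in `K`. The class of
`(f, d)` consists of the maps of degree at most `d` that differ from `f` by a map of degree less
than `d`. -/
def IsDegreeCover [AddCommMonoid M] (K : Multiset ((M → H) × ℕ)) (A : Set (M → H)) : Prop :=
  ∀ p ∈ A, ∃ k ∈ K, p ∈ degreeLT M H (k.2 + 1) ∧ p - k.1 ∈ degreeLT M H k.2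

theorem shiftedFamily_apply_zero [AddZeroClass M] {q : M → H} (hq : q 0 = 0) (Y : Set M) :
    ∀ g ∈ shiftedFamily A q Y, g 0 = 0 := by
  rintro - ⟨p, -, y, -, rfl⟩
  simp [hq]

theorem IsDegreeCover.to_shiftedFamily [AddCommMonoid M] {f q : M → H} {d : ℕ}
    (hA0 : ∀ p ∈ A, p 0 = 0) (hK : IsDegreeCover ((f, d + 1) ::ₘ K) A)
    (hmin : ∀ k ∈ K, d + 1 ≤ k.2) (hq : q ∈ degreeLT M H (d + 2))
    (hqf : q - f ∈ degreeLT M H (d + 1)) {Y : Set M} (hfin : (shiftedFamily A q Y).Finite) :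
    IsDegreeCover (K.map (fun k => (k.1 - q, k.2)) + hfin.toFinset.val.map (fun g => (g, d)))
      (shiftedFamily A q Y) := by
  intro g hg
  obtain ⟨p, hp, y, -, hgp⟩ := id hg
  have hdecomp : g = (fun x => Δ_[y] p x - p y) + (p - q) := by
    rw [← hgp]
    ext x
    simp only [fwdDiff, Pi.add_apply, Pi.sub_apply]
    abel
  obtain ⟨k, hk, hpk, hpf⟩ := hK p hp
  have hΔ := fwdDiff_sub_const_mem_degreeLT hpk (hA0 p hp) y
  rcases Multiset.mem_cons.1 hk with rfl | hkK
  · have hgdeg : g ∈ degreeLT M H (d + 1) := by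
      rw [hdecomp, ← sub_sub_sub_cancel_right p q f]
      exact add_mem hΔ (sub_mem hpf hqf)
    exact ⟨(g, d), Multiset.mem_add.2 (.inr (Multiset.mem_map_of_mem _ (hfin.mem_toFinset.2 hg))),
      hgdeg, by simp⟩
  · have hgdeg : g ∈ degreeLT M H (k.2 + 1) := by
      rw [hdecomp]
      exact add_mem (degreeLT_mono k.2.le_succ hΔ)
        (sub_mem hpk (degreeLT_mono (Nat.succ_le_succ (hmin k hkK)) hq))
    have hgk : g - (k.1 - q) ∈ degreeLT M H k.2 := by
      rw [hdecomp, add_sub_assoc, sub_sub_sub_cancel_right]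
      exact add_mem hΔ hpf
    exact ⟨_, Multiset.mem_add.2 (.inl (Multiset.mem_map_of_mem _ hkK)), hgdeg, hgk⟩

theorem exists_eq_cons_forall_le {α β : Type*} [LinearOrder β] (f : α → β) {s : Multiset α}
    (hs : s ≠ 0) : ∃ a t, s = a ::ₘ t ∧ ∀ b ∈ t, f a ≤ f b := by
  classical
  obtain ⟨a, ha, hmin⟩ := s.toFinset.exists_min_image f (by simpa using hs)
  obtain ⟨t, rfl⟩ := Multiset.exists_cons_of_mem (Multiset.mem_toFinset.1 ha)
  exact ⟨a, t, rfl, fun b hb => hmin b (by simp [hb])⟩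

theorem cutExpand_add_cons {α : Type*} {r : α → α → Prop} {a : α} {s t : Multiset α}
    (ht : ∀ b ∈ t, r b a) : Relation.CutExpand r (s + t) (a ::ₘ s) := by
  rw [← Multiset.singleton_add, add_comm {a} s]
  exact (Relation.cutExpand_add_left s).2 (Relation.cutExpand_singleton ht)

theorem IsDegreeCover.isPartitionRegular [AddCancelCommMonoid M] [Infinite M] (hA : A.Finite)
    (hA0 : ∀ p ∈ A, p 0 = 0) (hK : IsDegreeCover K A) : IsPartitionRegular A := by
  induction hm : K.map Prod.snd using (wellFounded_lt (α := ℕ)).cutExpand.induction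
    generalizing K A with
  | _ m ih
  subst hm
  rcases eq_or_ne K 0 with rfl | hK0
  · obtain rfl : A = ∅ := Set.eq_empty_of_forall_notMem fun p hp => by simpa using hK p hp
    exact .empty
  obtain ⟨⟨f, d⟩, K, rfl, hmin⟩ := exists_eq_cons_forall_le Prod.snd hK0
  rw [Multiset.map_cons] at ih
  by_cases hq : ∃ q ∈ A, q ≠ 0 ∧ q ∈ degreeLT M H (d + 1) ∧ q - f ∈ degreeLT M H d
  · obtain ⟨q, hqA, hq0, hq, hqf⟩ := hq
    obtain _ | d := d
    · exact absurd (eq_zero_of_mem_degreeLT_one hq (hA0 q hqA)) hq0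
    refine .of_shiftedFamily hA hA0 q fun Y hY => ?_
    have hfin : (shiftedFamily A q Y).Finite := hA.image2 _ hY
    refine ih _ ?_ hfin (shiftedFamily_apply_zero (hA0 q hqA) Y)
      (hK.to_shiftedFamily hA0 hmin hq hqf hfin) rfl
    simp only [Multiset.map_add, Multiset.map_map]
    refine cutExpand_add_cons fun e he => ?_
    obtain ⟨g, -, rfl⟩ := Multiset.mem_map.1 he
    exact d.lt_succ_self
  · have hcover : IsDegreeCover K (A \ {0}) := fun p ⟨hp, hp0⟩ => by
      obtain ⟨k, hk, hpk⟩ := hK p hp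
      rcases Multiset.mem_cons.1 hk with rfl | hk
      · exact absurd ⟨p, hp, hp0, hpk⟩ hq
      · exact ⟨k, hk, hpk⟩
    refine .of_diff_zero (ih _ ?_ hA.sdiff (fun p hp => hA0 p hp.1) hcover rfl)
    simpa using cutExpand_add_cons (s := K.map Prod.snd) (t := 0) (r := (· < ·)) (a := d) (by simp)

theorem isPartitionRegular_of_mem_degreeLT [AddCancelCommMonoid M] [Infinite M] (hA : A.Finite)
    (hA0 : ∀ p ∈ A, p 0 = 0) (hdeg : ∀ p ∈ A, ∃ d, p ∈ degreeLT M H d) : IsPartitionRegular A := by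
  choose! d hd using hdeg
  refine IsDegreeCover.isPartitionRegular (K := hA.toFinset.val.map fun p => (p, d p)) hA hA0
    fun p hp => ⟨(p, d p), Multiset.mem_map_of_mem _ (hA.mem_toFinset.2 hp), ?_, by simp⟩
  exact degreeLT_mono (d p).le_succ (hd p hp)

end DegreeCover

theorem corollary7p11_general {G : Type*} [NonUnitalRing G] [Infinite G] {n t : ℕ}
    {P : (Fin n → G) → (Fin t → G)} (hP : IsPolynomialMapping P)
    {F : Set (Fin n → G)} (hF : F.Finite) {S : Set G} (hS : S.Finite)
    {C : Type*} [Finite C] (χ : (Fin t → G) → C) :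
    ∃ (h : Fin t → G) (x : G), x ∉ S ∧
      IsMonochromatic χ ((fun v => h + P (fun i => x * v i)) '' F) := by
  have hreg : IsPartitionRegular ((fun v (x : G) => P (fun i => x * v i) - P 0) '' F) := by
    refine isPartitionRegular_of_mem_degreeLT (hF.image _) ?_ ?_
    · rintro - ⟨v, -, rfl⟩
      simp only [zero_mul]
      exact sub_self (P 0)
    · rintro - ⟨v, -, rfl⟩
      obtain ⟨d, hd⟩ := hP.exists_mem_degreeLT v
      exact ⟨d + 1, sub_mem (degreeLT_mono d.le_succ hd) (const_mem_degreeLT d (P 0))⟩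
  obtain ⟨h, x, hx, hχ⟩ := hreg.exists_of_finite χ hS
  have hconst : ∀ v ∈ F, χ (h - P 0 + P fun i => x * v i) = χ h := fun v hv => by
    rw [← hχ _ (Set.mem_image_of_mem _ hv), sub_add_eq_add_sub, add_sub_assoc]
  refine ⟨h - P 0, x, hx, ?_⟩
  rintro - ⟨v, hv, rfl⟩ - ⟨w, hw, rfl⟩
  exact (hconst v hv).trans (hconst w hw).symm

theorem corollary7p11 {G : Type*} [NonUnitalRing G] [Infinite G] (n t : ℕ)
    (P : (Fin n → G) → (Fin t → G)) (hP : IsPolynomialMapping P) (hP0 : P 0 = 0)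
    (F : Set (Fin n → G)) (hF : F.Finite)
    (r : ℕ) (χ : (Fin t → G) → Fin r) :
    ∃ (h : Fin t → G) (x : G), x ≠ 0 ∧
      IsMonochromatic χ ((fun v => h + P (fun i => x * v i)) '' F) :=
  corollary7p11_general hP hF (Set.finite_singleton 0) χ
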